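/- Let $F$ be a field of characteristic different from $2$. A (not necessarily associative or unital) $F$-algebra $A$ is a Novikov algebra if $(x,y,z)=(y,x,z)$ and $(xy)z=(xz)y$ for all $x,y,z\in A$, where $(x,y,z)=(xy)z-x(yz)$. Put $A^{(0)_L}=A$ and let $A^{(n+1)_L}$ be the subspace spanned by all commutators $xy-yx$ with $x,y\in A^{(n)_L}$; $A$ is Lie-solvable if $A^{(n)_L}=0$ for some $n\ge 0$. Theorem. For every Lie-solvable Novikov algebra $A$ over $F$, the following conditions are equivalent: 1. $A$ is Baer-radical, that is, $A=\mathcal B(A)$. Here $\mathcal B_0(A)=0$; $\mathcal B_{\alpha+1}(A)$ is the preimage in $A$ of the sum of all ideals with zero multiplication of $A/\mathcal B_\alpha(A)$; $\mathcal B_\alpha(A)=\bigcup_{\beta<\alpha}\mathcal B_\beta(A)$ for limit ordinals $\alpha$; and $\mathcal B(A)=\mathcal B_\delta(A)$ for an ordinal $\delta$ whose cardinality is greater than $|A|$. 2. $A$ is r-nil, that is, for every $x\in A$ there is $n\ge 1$ with $x^n=0$, where $x^1=x$ and $x^{n+1}=x^n x$. 3. $A$ is locally solvable, that is, every finitely generated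 subalgebra $B$ of $A$ is solvable: $B^{(m)}=0$ for some $m\ge 0$, where $B^{(0)}=B$ and $B^{(m+1)}$ is the subspace spanned by all products $xy$ with $x,y\in B^{(m)}$. In other words, within the class of Lie-solvable Novikov algebras over $F$, the Baer-radical algebras, the r-nil algebras and the locally solvable algebras form the same class. -/

import Mathlib

universe u v

namespace NovikovAlgebra

/-- A nonassociative ring (or algebra) is Novikov if `(x,y,z) = (y,x,z)` and `(xy)z = (xz)y`,
where `(x,y,z) = (xy)z - x(yz)` is Mathlib's `associator`. -/
structure IsNovikov (A : Type v) [NonUnitalNonAssocRing A] : Prop where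
  left_symm : ∀ x y z : A, associator x y z = associator y x z
  right_comm : ∀ x y z : A, (x * y) * z = (x * z) * y

section Nil

variable {A : Type v} [NonUnitalNonAssocRing A]

/-- Left-normed powers, with the index shifted by one so that only the powers `x ^ m`, `m ≥ 1`,
occur: `leftPowSucc x n` is `x ^ (n + 1)`, where `x ^ 1 = x` and `x ^ (m + 1) = x ^ m * x`. -/
def leftPowSucc (x : A) : ℕ → A
  | 0 => x
  | n + 1 => leftPowSucc x n * x

/-- `x` is r-nilpotent: some left-normed power `x ^ m`, `m ≥ 1`, vanishes. -/
def IsRNilpotent (x : A) : Prop := ∃ n : ℕ, leftPowSucc x n = 0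

end Nil

/-- Every element is r-nilpotent. -/
def IsRNil (A : Type v) [NonUnitalNonAssocRing A] : Prop := ∀ x : A, IsRNilpotent x

section Algebra

variable (F : Type u) (A : Type v) [Field F] [NonUnitalNonAssocRing A] [Module F A]

/-- The Lie-solvable powers: the whole algebra at `0`, and at `n + 1` the subspace spanned
by all commutators `xy - yx` of elements of the `n`-th power. -/
def lieSolvablePower : ℕ → Submodule F A
  | 0 => ⊤
  | n + 1 => Submodule.span F
      {c : A | ∃ x ∈ lieSolvablePower n, ∃ y ∈ lieSolvablePower n, x * y - y * x = c}

def IsLieSolvable : Prop := ∃ n : ℕ, lieSolvablePower F A n = ⊥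

/-- The derived powers: the whole algebra at `0`, and at `n + 1` the subspace spanned by all
products of two elements of the `n`-th power. -/
def derivedPower : ℕ → Submodule F A
  | 0 => ⊤
  | n + 1 => Submodule.span F
      {c : A | ∃ x ∈ derivedPower n, ∃ y ∈ derivedPower n, x * y = c}

def IsSolvableAlgebra : Prop := ∃ n : ℕ, derivedPower F A n = ⊥

/-- Every finitely generated subalgebra is solvable. -/
def IsLocallySolvable [IsScalarTower F A A] [SMulCommClass F A A] : Prop :=
  ∀ s : Finset A, IsSolvableAlgebra F (NonUnitalAlgebra.adjoin F (s : Set A))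

variable {F A}

/-- Two-sided ideals of the algebra. -/
def IsIdeal (I : Submodule F A) : Prop := ∀ a : A, ∀ x ∈ I, a * x ∈ I ∧ x * a ∈ I

/-- For an ideal `I`, the preimage in `A` of the sum of all trivial ideals of `A / I`. Ideals of
`A / I` are the `J / I` with `J` an ideal of `A` containing `I`, and `J / I` has zero
multiplication exactly when `J * J ⊆ I`. For `I = 0` this is the sum of all trivial ideals. -/
def trivialSumOver (I : Submodule F A) : Submodule F A :=
  sSup {J : Submodule F A | IsIdeal J ∧ I ≤ J ∧ ∀ x ∈ J, ∀ y ∈ J, x * y ∈ I}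

variable (F A)

/-- The transfinite Baer chain: zero at `0`, the preimage of the sum of the trivial ideals of the
quotient by the previous term at a successor, and the union of the previous terms (which form an
increasing chain, so that their union is their supremum) at a limit ordinal. -/
noncomputable def baerChain (α : Ordinal.{v}) : Submodule F A :=
  Ordinal.limitRecOn (motive := fun _ => Submodule F A) α
    ⊥
    (fun _ I => trivialSumOver I)
    (fun o _ ih => ⨆ (β : Ordinal.{v}) (hβ : β < o), ih β hβ)

/-- The Baer radical: the term of the Baer chain at an ordinal of cardinality larger
than that of `A`, where the chain has become stationary. -/
noncomputable def baerRadical : Submodule F A :=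
  baerChain F A (Order.succ (Cardinal.mk A)).ord

/-- The algebra coincides with its Baer radical. -/
def IsBaerRadical : Prop := baerRadical F A = ⊤

end Algebra

end NovikovAlgebra

/-! In every Novikov algebra, x^(2k+5) is an integral combination of (x^(k+2) x^(k+2)) x and x^(k+2)
x^(k+3) (`leftPowSucc_eq_combination`). Nilpotency modulo an ideal L therefore descends to
nilpotency modulo an ideal K containing L², so solvable algebras and Baer-radical algebras are
r-nil. Conversely, let C be the span of all commutators. The Lie powers are ideals because 2 is
invertible, and Lie-solvability makes C solvable (`mul_mul_mem_lieSolvablePower`). The quotient A/C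
is commutative, hence associative, so an r-nilpotent element lies in an ideal solvable modulo C,
hence solvable (`exists_isSolvableOver_bot_mem`). Finite sums of solvable ideals are solvable, which
gives local solvability. Squares of ideals are ideals, so every solvable ideal lies in the Baer
radical. -/

namespace NovikovAlgebra

/-! ### Identities for associators, commutators and left-normed powers. -/

section Ring

variable {A : Type v} [NonUnitalNonAssocRing A]

theorem IsNovikov.mul_mul_eq (h : IsNovikov A) (x y z : A) :
    x * (y * z) = x * y * z - y * x * z + y * (x * z) := by
  have := h.left_symm x y z
  simp only [associator] at this
  rw [sub_eq_sub_iff_add_eq_add] at this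
  rw [sub_add_eq_add_sub, eq_sub_iff_add_eq, this, add_comm]

theorem IsNovikov.associator_mul_left (h : IsNovikov A) (f g x y : A) :
    associator (f * g) x y = associator f x y * g := by
  simp only [associator, sub_mul]
  rw [h.right_comm f g x, h.right_comm (f * x) g y, h.right_comm f g (x * y)]

/-- A product with a commutator on the right is a difference of associators. -/
theorem IsNovikov.mul_commutator (h : IsNovikov A) (f x y : A) :
    f * (x * y - y * x) = associator f y x - associator f x y := by
  simp only [associator, mul_sub]
  rw [h.right_comm f y x]
  abel

theorem IsNovikov.associator_eq_commutators (h : IsNovikov A) (a b c : A) :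
    associator a b c = (a * b - b * a) * c + (b * c * a - a * (b * c)) := by
  rw [associator, sub_mul, h.right_comm b c a]
  abel

theorem IsNovikov.two_nsmul_commutator_mul (h : IsNovikov A) (x y z : A) :
    2 • ((x * y - y * x) * z) =
      (x * z * y - y * (x * z)) + (x * (y * z) - y * z * x) := by
  rw [h.mul_mul_eq x y z, h.right_comm x z y, h.right_comm y z x, sub_mul, two_nsmul]
  abel

/-- The left-symmetric form of the Jacobi identity. -/
theorem IsNovikov.mul_commutator_eq (h : IsNovikov A) (x y z : A) :
    z * (x * y - y * x) = (x * y - y * x) * z +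
      (((z * x - x * z) * y - y * (z * x - x * z)) +
        (x * (z * y - y * z) - (z * y - y * z) * x)) := by
  have h1 := h.mul_mul_eq z x y
  have h2 := h.mul_mul_eq z y x
  have h3 := h.mul_mul_eq x y z
  simp only [mul_sub, sub_mul]
  rw [h1, h2, h3]
  abel

theorem leftPowSucc_mul (h : IsNovikov A) (x y : A) (n : ℕ) :
    leftPowSucc x n * y = (fun a => a * x)^[n] (x * y) := by
  induction n with
  | zero => rfl
  | succ n ih =>
    rw [Function.iterate_succ_apply', ← ih]
    exact h.right_comm _ _ _

theorem iterate_mul_leftPowSucc (x : A) (m n : ℕ) :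
    (fun a => a * x)^[m] (leftPowSucc x n) = leftPowSucc x (n + m) := by
  induction m with
  | zero => rfl
  | succ m ih => rw [Function.iterate_succ_apply', ih]; rfl

/-- With R the right multiplication by x, left symmetry applied to x (x^(k+2) x) contributes one
more R^(k+1)(x x²) and one more -x^(k+4) at each step. -/
theorem mul_leftPowSucc (h : IsNovikov A) (x : A) (k : ℕ) :
    x * leftPowSucc x (k + 1) =
      (k + 1) • (fun a => a * x)^[k] (x * (x * x)) - k • leftPowSucc x (k + 2) := by
  induction k with
  | zero => simp [leftPowSucc]
  | succ k ih =>
    have e : leftPowSucc x (k + 1 + 1) = leftPowSucc x (k + 1) * x := rfl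
    rw [e, h.mul_mul_eq, ih, leftPowSucc_mul h x (x * x) (k + 1), Function.iterate_succ_apply',
      sub_mul, smul_mul_assoc, smul_mul_assoc]
    change _ - k • leftPowSucc x (k + 3) - leftPowSucc x (k + 3) + _ =
      _ - (k + 1) • leftPowSucc x (k + 3)
    simp only [add_smul, one_smul]
    abel

theorem leftPowSucc_mul_leftPowSucc (h : IsNovikov A) (x : A) (k j : ℕ) :
    leftPowSucc x j * leftPowSucc x (k + 1) =
      (k + 1) • (fun a => a * x)^[k + j] (x * (x * x)) - k • leftPowSucc x (k + 2 + j) := by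
  have hsub : ∀ a b, (fun a => a * x)^[j] (a - b) = _ :=
    iterate_map_sub (AddMonoidHom.mulRight x) j
  have hsmul : ∀ (n : ℕ) a, (fun a => a * x)^[j] (n • a) = n • (fun a => a * x)^[j] a :=
    fun n a => iterate_map_nsmul (AddMonoidHom.mulRight x) j a n
  rw [leftPowSucc_mul h, mul_leftPowSucc h, hsub, AddMonoidHom.coe_mulRight, hsmul, hsmul,
    iterate_mul_leftPowSucc, add_comm k j, Function.iterate_add_apply]

/-- A left-normed power of high exponent is an explicit combination of products of two equal
or consecutive powers. -/
theorem leftPowSucc_eq_combination (h : IsNovikov A) (x : A) (k : ℕ) :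
    leftPowSucc x (2 * k + 4) =
      (k + 2) • (leftPowSucc x (k + 1) * leftPowSucc x (k + 1) * x) -
      (k + 1) • (leftPowSucc x (k + 1) * leftPowSucc x (k + 2)) := by
  rw [leftPowSucc_mul_leftPowSucc h x (k + 1) (k + 1), leftPowSucc_mul_leftPowSucc h x k (k + 1),
    sub_mul, smul_mul_assoc, smul_mul_assoc]
  have e1 : (fun a => a * x)^[k + (k + 1)] (x * (x * x)) * x =
      (fun a => a * x)^[k + 1 + (k + 1)] (x * (x * x)) := by
    rw [show k + 1 + (k + 1) = (k + (k + 1)) + 1 by ring, Function.iterate_succ_apply']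
  have e2 : leftPowSucc x (k + 2 + (k + 1)) * x = leftPowSucc x (2 * k + 4) := by
    rw [show 2 * k + 4 = k + 2 + (k + 1) + 1 by ring]; rfl
  have e3 : k + 1 + 2 + (k + 1) = 2 * k + 4 := by ring
  rw [e1, e2, e3]
  -- The coefficients cancel w and leave p with (k+1)² - k(k+2) = 1, so nothing has to be divided.
  generalize (fun a => a * x)^[k + 1 + (k + 1)] (x * (x * x)) = w
  generalize leftPowSucc x (2 * k + 4) = p
  module

end Ring

/-! ### Ideals, their squares, and solvability modulo an ideal. -/

section Algebra

variable {F : Type u} {A : Type v} [Field F] [NonUnitalNonAssocRing A] [Module F A]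

theorem IsIdeal.mul_left_mem {I : Submodule F A} (hI : IsIdeal I) (a : A) {x : A} (hx : x ∈ I) :
    a * x ∈ I := (hI a x hx).1

theorem IsIdeal.mul_right_mem {I : Submodule F A} (hI : IsIdeal I) (a : A) {x : A} (hx : x ∈ I) :
    x * a ∈ I := (hI a x hx).2

theorem isIdeal_bot : IsIdeal (⊥ : Submodule F A) := by
  intro a x hx
  rw [Submodule.mem_bot] at hx
  simp [hx]

theorem isIdeal_top : IsIdeal (⊤ : Submodule F A) := fun _ _ _ => ⟨trivial, trivial⟩

theorem isIdeal_sSup {S : Set (Submodule F A)} (hS : ∀ I ∈ S, IsIdeal I) : IsIdeal (sSup S) := by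
  intro a x hx
  rw [sSup_eq_iSup'] at hx
  induction hx using Submodule.iSup_induction' with
  | mem i x hx =>
    exact ⟨le_sSup i.2 (hS i i.2 a x hx).1, le_sSup i.2 (hS i i.2 a x hx).2⟩
  | zero => simp
  | add x y _ _ hx hy =>
    rw [mul_add, add_mul]
    exact ⟨add_mem hx.1 hy.1, add_mem hx.2 hy.2⟩

theorem IsIdeal.sup {I J : Submodule F A} (hI : IsIdeal I) (hJ : IsIdeal J) :
    IsIdeal (I ⊔ J) := by
  rw [← sSup_pair]
  apply isIdeal_sSup
  rintro K (rfl | rfl)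
  exacts [hI, hJ]

/-- If `J` has products in `I`, then `I ⊔ J` has products in `I`. -/
theorem IsIdeal.mul_mem_of_mem_sup {I J : Submodule F A} (hI : IsIdeal I)
    (hJ : ∀ x ∈ J, ∀ y ∈ J, x * y ∈ I) {x y : A} (hx : x ∈ I ⊔ J) (hy : y ∈ I ⊔ J) :
    x * y ∈ I := by
  obtain ⟨a, ha, b, hb, rfl⟩ := Submodule.mem_sup.1 hx
  obtain ⟨c, hc, d, hd, rfl⟩ := Submodule.mem_sup.1 hy
  rw [add_mul, mul_add b]
  exact add_mem (hI.mul_right_mem _ ha) (add_mem (hI.mul_left_mem _ hc) (hJ _ hb _ hd))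

/-- The span of all products of two elements of a subspace. -/
def mulSpan (K : Submodule F A) : Submodule F A :=
  Submodule.span F {c : A | ∃ x ∈ K, ∃ y ∈ K, x * y = c}

theorem mul_mem_mulSpan {K : Submodule F A} {x y : A} (hx : x ∈ K) (hy : y ∈ K) :
    x * y ∈ mulSpan K := Submodule.subset_span ⟨x, hx, y, hy, rfl⟩

theorem mulSpan_le {K L : Submodule F A} : mulSpan K ≤ L ↔ ∀ x ∈ K, ∀ y ∈ K, x * y ∈ L := by
  refine ⟨fun h x hx y hy => h (mul_mem_mulSpan hx hy), fun h => Submodule.span_le.2 ?_⟩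
  rintro _ ⟨x, hx, y, hy, rfl⟩
  exact h x hx y hy

theorem mulSpan_mono : Monotone (mulSpan : Submodule F A → Submodule F A) := fun _ _ h =>
  mulSpan_le.2 fun _ hx _ hy => mul_mem_mulSpan (h hx) (h hy)

theorem isIdeal_span [IsScalarTower F A A] [SMulCommClass F A A] {S : Set A}
    (hS : ∀ a : A, ∀ x ∈ S, a * x ∈ Submodule.span F S ∧ x * a ∈ Submodule.span F S) :
    IsIdeal (Submodule.span F S) := by
  intro a x hx
  induction hx using Submodule.span_induction with
  | mem x hx => exact hS a x hx
  | zero => simp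
  | add x y _ _ hx hy =>
    rw [mul_add, add_mul]
    exact ⟨add_mem hx.1 hy.1, add_mem hx.2 hy.2⟩
  | smul c x _ hx =>
    rw [mul_smul_comm, smul_mul_assoc]
    exact ⟨Submodule.smul_mem _ _ hx.1, Submodule.smul_mem _ _ hx.2⟩

theorem IsIdeal.mulSpan [IsScalarTower F A A] [SMulCommClass F A A]
    (h : IsNovikov A) {I : Submodule F A} (hI : IsIdeal I) :
    IsIdeal (mulSpan I) := by
  apply isIdeal_span
  rintro a _ ⟨x, hx, y, hy, rfl⟩
  constructor
  · rw [h.mul_mul_eq]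
    exact add_mem (sub_mem (mul_mem_mulSpan (hI.mul_left_mem _ hx) hy)
      (mul_mem_mulSpan (hI.mul_right_mem _ hx) hy)) (mul_mem_mulSpan hx (hI.mul_left_mem _ hy))
  · rw [h.right_comm]
    exact mul_mem_mulSpan (hI.mul_right_mem _ hx) hy

theorem iterate_mulSpan_sup_le {I J : Submodule F A} (hJ : IsIdeal J) (m : ℕ) :
    mulSpan^[m] (I ⊔ J) ≤ mulSpan^[m] I ⊔ J := by
  induction m with
  | zero => exact le_rfl
  | succ m ih =>
    rw [Function.iterate_succ_apply', Function.iterate_succ_apply']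
    refine (mulSpan_mono ih).trans (mulSpan_le.2 fun x hx y hy => ?_)
    obtain ⟨a, ha, b, hb, rfl⟩ := Submodule.mem_sup.1 hx
    obtain ⟨c, hc, d, hd, rfl⟩ := Submodule.mem_sup.1 hy
    rw [mul_add, add_mul, add_assoc]
    exact Submodule.add_mem_sup (mul_mem_mulSpan ha hc)
      (add_mem (hJ.mul_right_mem _ hb) (hJ.mul_left_mem _ hd))

/-- `J` is an ideal containing `I` and solvable modulo `I`. -/
structure IsSolvableOver (I J : Submodule F A) : Prop where
  isIdeal : IsIdeal J
  le : I ≤ J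
  solvable : ∃ m : ℕ, mulSpan^[m] J ≤ I

theorem IsSolvableOver.refl {I : Submodule F A} (hI : IsIdeal I) : IsSolvableOver I I :=
  ⟨hI, le_rfl, 0, le_rfl⟩

/-- Modulo K only J matters: m squarings bring J ⊔ K into K, and n more bring K into I. -/
theorem IsSolvableOver.sup {I J K : Submodule F A} (hJ : IsSolvableOver I J)
    (hK : IsSolvableOver I K) : IsSolvableOver I (J ⊔ K) := by
  obtain ⟨m, hm⟩ := hJ.solvable
  obtain ⟨n, hn⟩ := hK.solvable
  refine ⟨hJ.isIdeal.sup hK.isIdeal, hJ.le.trans le_sup_left, n + m, ?_⟩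
  rw [Function.iterate_add_apply]
  refine (mulSpan_mono.iterate n ?_).trans hn
  exact (iterate_mulSpan_sup_le hK.isIdeal m).trans (sup_le (hm.trans hK.le) le_rfl)

/-! ### Solvable and locally solvable algebras are r-nil. -/

/-- Nilpotency of `x` modulo `L` gives nilpotency modulo `K` when `L` is trivial over `K`. -/
theorem exists_leftPowSucc_mem_of_mul_mem (h : IsNovikov A) {K L : Submodule F A}
    (hK : IsIdeal K) (hL : IsIdeal L) (hKL : ∀ x ∈ L, ∀ y ∈ L, x * y ∈ K) {x : A} {n : ℕ}
    (hx : leftPowSucc x n ∈ L) : ∃ m, leftPowSucc x m ∈ K := by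
  refine ⟨2 * n + 4, ?_⟩
  have h1 : leftPowSucc x (n + 1) ∈ L := hL.mul_right_mem _ hx
  have h2 : leftPowSucc x (n + 2) ∈ L := hL.mul_right_mem _ h1
  rw [leftPowSucc_eq_combination h]
  exact sub_mem (nsmul_mem (hK.mul_right_mem _ (hKL _ h1 _ h1)) _) (nsmul_mem (hKL _ h1 _ h2) _)

theorem IsRNil.of_isSolvableAlgebra [IsScalarTower F A A] [SMulCommClass F A A]
    (h : IsNovikov A) (hA : IsSolvableAlgebra F A) :
    IsRNil A := by
  obtain ⟨n, hn⟩ := hA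
  have hI : ∀ k, IsIdeal (derivedPower F A k) := by
    intro k
    induction k with
    | zero => exact isIdeal_top
    | succ k ih => exact ih.mulSpan h
  intro x
  have key : ∀ k, ∃ m, leftPowSucc x m ∈ derivedPower F A k := by
    intro k
    induction k with
    | zero => exact ⟨0, trivial⟩
    | succ k ih =>
      obtain ⟨m, hm⟩ := ih
      exact exists_leftPowSucc_mem_of_mul_mem h (hI (k + 1)) (hI k)
        (fun _ ha _ hb => mul_mem_mulSpan ha hb) hm
  obtain ⟨m, hm⟩ := key n
  rw [hn] at hm
  exact ⟨m, hm⟩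

theorem IsRNil.of_isLocallySolvable [IsScalarTower F A A] [SMulCommClass F A A]
    (h : IsNovikov A) (hA : IsLocallySolvable F A) :
    IsRNil A := by
  intro x
  let S := NonUnitalAlgebra.adjoin F (({x} : Finset A) : Set A)
  have hS : IsNovikov S :=
    ⟨fun a b c => Subtype.ext (h.left_symm a b c), fun a b c => Subtype.ext (h.right_comm a b c)⟩
  have hx : x ∈ S := NonUnitalAlgebra.subset_adjoin F (by simp)
  obtain ⟨n, hn⟩ := IsRNil.of_isSolvableAlgebra hS (hA {x}) ⟨x, hx⟩
  have e : ∀ k, ((leftPowSucc (⟨x, hx⟩ : S) k : S) : A) = leftPowSucc x k := by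
    intro k
    induction k with
    | zero => rfl
    | succ k ih => exact congrArg (· * x) ih
  exact ⟨n, by rw [← e, hn]; rfl⟩

/-! ### The Baer chain and its stationarity. -/

section Baer

theorem baerChain_zero : baerChain F A 0 = ⊥ := by
  rw [baerChain, Ordinal.limitRecOn_zero]

theorem baerChain_add_one (α : Ordinal.{v}) :
    baerChain F A (α + 1) = trivialSumOver (baerChain F A α) := by
  rw [baerChain, Ordinal.limitRecOn_add_one]; rfl

theorem baerChain_limit {α : Ordinal.{v}} (hα : Order.IsSuccLimit α) :
    baerChain F A α = ⨆ (β : Ordinal.{v}) (_ : β < α), baerChain F A β := by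
  rw [baerChain, Ordinal.limitRecOn_limit _ _ _ _ hα]; rfl

theorem isIdeal_trivialSumOver (I : Submodule F A) : IsIdeal (trivialSumOver I) :=
  isIdeal_sSup fun _ hJ => hJ.1

theorem le_trivialSumOver {I : Submodule F A} (hI : IsIdeal I) : I ≤ trivialSumOver I :=
  le_sSup ⟨hI, le_rfl, fun x _ _ hy => hI.mul_left_mem x hy⟩

theorem isIdeal_baerChain (α : Ordinal.{v}) : IsIdeal (baerChain F A α) := by
  induction α using Ordinal.limitRecOn with
  | zero => rw [baerChain_zero]; exact isIdeal_bot
  | add_one α _ => rw [baerChain_add_one]; exact isIdeal_trivialSumOver _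
  | limit α hα ih =>
    rw [baerChain_limit hα, iSup_subtype', ← sSup_range]
    apply isIdeal_sSup
    rintro _ ⟨β, rfl⟩
    exact ih β β.2

theorem baerChain_mono : Monotone (baerChain F A) := by
  intro α β hαβ
  induction β using Ordinal.limitRecOn with
  | zero => rw [nonpos_iff_eq_zero.1 hαβ]
  | add_one β ih =>
    rcases hαβ.lt_or_eq with hlt | rfl
    · rw [baerChain_add_one]
      exact (ih (Order.lt_add_one_iff.1 hlt)).trans (le_trivialSumOver (isIdeal_baerChain _))
    · exact le_rfl
  | limit β hβ ih =>
    rcases hαβ.lt_or_eq with hlt | rfl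
    · rw [baerChain_limit hβ]
      exact le_iSup₂_of_le α hlt le_rfl
    · exact le_rfl

variable (F A) in
/-- The Baer chain becomes stationary before the ordinal defining the Baer radical. -/
theorem exists_baerChain_add_one_eq :
    ∃ α < (Order.succ (Cardinal.mk A)).ord, baerChain F A (α + 1) = baerChain F A α := by
  by_contra! hne
  -- A chain that never stops gains a new element at each stage, which would inject the successor
  -- cardinal of |A| into A.
  have hex : ∀ α : Set.Iio (Order.succ (Cardinal.mk A)).ord,
      ∃ x, x ∈ baerChain F A (α + 1) ∧ x ∉ baerChain F A α := fun α =>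
    SetLike.exists_of_lt ((baerChain_mono (le_add_of_nonneg_right zero_le_one)).lt_of_ne
      (hne α α.2).symm)
  choose f hf hf' using hex
  have hlt : ∀ α β, α < β → f α ≠ f β := fun α β hαβ e =>
    hf' β (e ▸ baerChain_mono (Order.add_one_le_of_lt hαβ) (hf α))
  have hinj : Function.Injective f := by
    intro α β e
    rcases lt_trichotomy α β with hαβ | hαβ | hαβ
    exacts [absurd e (hlt _ _ hαβ), hαβ, absurd e.symm (hlt _ _ hαβ)]
  -- The initial segment of ordinals lives one universe above A, hence the lift.
  have := Cardinal.mk_le_of_injective (Function.Injective.comp ULift.up_injective hinj :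
    Function.Injective (fun α => (ULift.up.{v + 1} (f α))))
  rw [Cardinal.mk_Iio_ordinal, Cardinal.card_ord, Cardinal.mk_uLift, Cardinal.lift_le] at this
  exact absurd this (Order.lt_succ _).not_ge

theorem le_baerRadical_of_mul_mem {J : Submodule F A} (hJ : IsIdeal J)
    (h : ∀ x ∈ J, ∀ y ∈ J, x * y ∈ baerRadical F A) : J ≤ baerRadical F A := by
  obtain ⟨α, hα, e⟩ := exists_baerChain_add_one_eq F A
  have hstat : ∀ β ≥ α, baerChain F A β = baerChain F A α := by
    intro β hβ
    induction β using Ordinal.limitRecOn with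
    | zero => rw [nonpos_iff_eq_zero.1 hβ]
    | add_one β ih =>
      rcases hβ.lt_or_eq with hlt | rfl
      · rw [baerChain_add_one, ih (Order.lt_add_one_iff.1 hlt), ← baerChain_add_one, e]
      · rfl
    | limit β hlim ih =>
      refine le_antisymm ?_ (baerChain_mono hβ)
      rw [baerChain_limit hlim]
      refine iSup₂_le fun γ hγ => ?_
      rcases le_total γ α with hle | hle
      exacts [baerChain_mono hle, (ih γ hγ hle).le]
  have hrad : baerRadical F A = baerChain F A α := hstat _ hα.le
  have hI : IsIdeal (baerChain F A α) := isIdeal_baerChain _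
  rw [hrad] at h ⊢
  calc J ≤ baerChain F A α ⊔ J := le_sup_right
    _ ≤ trivialSumOver (baerChain F A α) :=
      le_sSup ⟨hI.sup hJ, le_sup_left, fun _ hx _ hy => hI.mul_mem_of_mem_sup h hx hy⟩
    _ = baerChain F A α := by rw [← baerChain_add_one, e]

end Baer

/-! ### The Baer radical compared with solvable ideals and with nilpotency. -/

theorem le_baerRadical_of_iterate_mulSpan_le [IsScalarTower F A A] [SMulCommClass F A A]
    (h : IsNovikov A) {J : Submodule F A}
    (hJ : IsIdeal J) (m : ℕ) (hm : mulSpan^[m] J ≤ baerRadical F A) : J ≤ baerRadical F A := by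
  induction m generalizing J with
  | zero => exact hm
  | succ m ih =>
    exact le_baerRadical_of_mul_mem hJ (mulSpan_le.1 (ih (hJ.mulSpan h) hm))

theorem exists_leftPowSucc_mem_of_mem_trivialSumOver (h : IsNovikov A) {I : Submodule F A}
    (hI : IsIdeal I) {x : A} {n : ℕ} (hx : leftPowSucc x n ∈ trivialSumOver I) :
    ∃ m, leftPowSucc x m ∈ I := by
  classical
  rw [trivialSumOver, sSup_eq_iSup', Submodule.mem_iSup_iff_exists_finset] at hx
  obtain ⟨s, hs⟩ := hx
  -- The element lies in a finite subsum. Its summands are peeled off one at a time, each partial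
  -- sum with I being trivial over the previous one.
  have key : IsIdeal (I ⊔ ⨆ i ∈ s, (i : Submodule F A)) ∧
      ∀ n, leftPowSucc x n ∈ I ⊔ ⨆ i ∈ s, (i : Submodule F A) → ∃ m, leftPowSucc x m ∈ I := by
    clear hs n
    induction s using Finset.induction_on with
    | empty =>
      simp only [Finset.notMem_empty, iSup_false, iSup_bot, sup_bot_eq]
      exact ⟨hI, fun n hn => ⟨n, hn⟩⟩
    | insert J s _ ih =>
      rw [Finset.iSup_insert, sup_left_comm, sup_comm]
      refine ⟨ih.1.sup J.2.1, fun n hn => ?_⟩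
      obtain ⟨m, hm⟩ := exists_leftPowSucc_mem_of_mul_mem h ih.1 (ih.1.sup J.2.1)
        (fun a ha b hb => ih.1.mul_mem_of_mem_sup
          (fun a ha b hb => le_sup_left (a := I) (J.2.2.2 a ha b hb)) ha hb) hn
      exact ih.2 m hm
  exact key.2 n (le_sup_right (a := I) hs)

theorem IsRNil.of_isBaerRadical (h : IsNovikov A) (hA : IsBaerRadical F A) : IsRNil A := by
  intro x
  have key : ∀ α : Ordinal.{v}, ∀ n, leftPowSucc x n ∈ baerChain F A α → IsRNilpotent x := by
    intro α
    induction α using Ordinal.limitRecOn with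
    | zero =>
      intro n hn
      rw [baerChain_zero] at hn
      exact ⟨n, hn⟩
    | add_one α ih =>
      intro n hn
      rw [baerChain_add_one] at hn
      obtain ⟨m, hm⟩ :=
        exists_leftPowSucc_mem_of_mem_trivialSumOver h (isIdeal_baerChain α) hn
      exact ih m hm
    | limit α hα ih =>
      intro n hn
      rw [baerChain_limit hα, iSup_subtype'] at hn
      have : Nonempty {β // β < α} := ⟨⟨0, hα.bot_lt⟩⟩
      rw [Submodule.mem_iSup_of_directed (fun β : {β // β < α} => baerChain F A β)
        (Monotone.directed_le fun a b hab => baerChain_mono hab)] at hn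
      obtain ⟨β, hβ⟩ := hn
      exact ih β β.2 n hβ
  refine key (Order.succ (Cardinal.mk A)).ord 0 ?_
  have : baerChain F A (Order.succ (Cardinal.mk A)).ord = ⊤ := hA
  rw [this]
  trivial

/-! ### Lie powers are ideals, and the commutator ideal is solvable. -/

theorem commutator_mem_lieSolvablePower {n : ℕ} {x y : A} (hx : x ∈ lieSolvablePower F A n)
    (hy : y ∈ lieSolvablePower F A n) : x * y - y * x ∈ lieSolvablePower F A (n + 1) :=
  Submodule.subset_span ⟨x, hx, y, hy, rfl⟩

theorem isIdeal_lieSolvablePower [IsScalarTower F A A] [SMulCommClass F A A]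
    (hF : (2 : F) ≠ 0) (h : IsNovikov A) (n : ℕ) :
    IsIdeal (lieSolvablePower F A n) := by
  induction n with
  | zero => exact isIdeal_top
  | succ n ih =>
    have hr : ∀ a x y : A, x ∈ lieSolvablePower F A n → y ∈ lieSolvablePower F A n →
        (x * y - y * x) * a ∈ lieSolvablePower F A (n + 1) := by
      intro a x y hx hy
      -- Here 2 is cancelled: 2[x,y]a = [xa,y] + [x,ya].
      rw [← Submodule.smul_mem_iff _ hF, ofNat_smul_eq_nsmul, h.two_nsmul_commutator_mul]
      exact add_mem (commutator_mem_lieSolvablePower (ih.mul_right_mem _ hx) hy)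
        (commutator_mem_lieSolvablePower hx (ih.mul_right_mem _ hy))
    apply isIdeal_span
    rintro a _ ⟨x, hx, y, hy, rfl⟩
    refine ⟨?_, hr a x y hx hy⟩
    rw [h.mul_commutator_eq]
    exact add_mem (hr a x y hx hy) (add_mem
      (commutator_mem_lieSolvablePower
        (sub_mem (ih.mul_left_mem _ hx) (ih.mul_right_mem _ hx)) hy)
      (commutator_mem_lieSolvablePower hx
        (sub_mem (ih.mul_left_mem _ hy) (ih.mul_right_mem _ hy))))

/-- If the ideal `J` is commutative modulo `K`, then `J²` annihilates commutators modulo `K`. -/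
theorem mul_mul_commutator_mem (h : IsNovikov A) {J K : Submodule F A} (hJ : IsIdeal J)
    (hK : IsIdeal K) (hJK : ∀ x ∈ J, ∀ y ∈ J, x * y - y * x ∈ K) {f g : A} (hf : f ∈ J)
    (hg : g ∈ J) (x y : A) : f * g * (x * y - y * x) ∈ K := by
  have h1 : ∀ a ∈ J, ∀ b ∈ J, ∀ c, associator a b c ∈ K := by
    intro a ha b hb c
    rw [h.associator_eq_commutators]
    exact add_mem (hK.mul_right_mem _ (hJK a ha b hb)) (hJK _ (hJ.mul_right_mem _ hb) _ ha)
  have h2 : ∀ x y, associator (f * g) x y ∈ K := by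
    intro x y
    -- (fg,x,y) = (f,x,y)g = (x,f,y)g = (xg,f,y), and both xg and f lie in J.
    rw [h.associator_mul_left, h.left_symm, ← h.associator_mul_left]
    exact h1 _ (hJ.mul_left_mem _ hg) _ hf _
  rw [h.mul_commutator]
  exact sub_mem (h2 y x) (h2 x y)

theorem mul_mul_mem_lieSolvablePower [IsScalarTower F A A] [SMulCommClass F A A]
    (hF : (2 : F) ≠ 0) (h : IsNovikov A) {n : ℕ} {f g c : A}
    (hf : f ∈ lieSolvablePower F A n) (hg : g ∈ lieSolvablePower F A n)
    (hc : c ∈ lieSolvablePower F A 1) : f * g * c ∈ lieSolvablePower F A (n + 1) := by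
  have hc' : c ∈ Submodule.span F {c : A | ∃ x ∈ lieSolvablePower F A 0,
      ∃ y ∈ lieSolvablePower F A 0, x * y - y * x = c} := hc
  clear hc
  induction hc' using Submodule.span_induction with
  | mem c hc =>
    obtain ⟨x, -, y, -, rfl⟩ := hc
    exact mul_mul_commutator_mem h (isIdeal_lieSolvablePower hF h n)
      (isIdeal_lieSolvablePower hF h (n + 1))
      (fun _ hx _ hy => commutator_mem_lieSolvablePower hx hy) hf hg x y
  | zero => simp
  | add x y _ _ hx hy => rw [mul_add]; exact add_mem hx hy
  | smul r x _ hx => rw [mul_smul_comm]; exact Submodule.smul_mem _ _ hx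

/-- Each Lie step costs two squarings: one to form products fg, one to multiply them by elements of
the commutator ideal. -/
theorem iterate_mulSpan_lieSolvablePower_one_le [IsScalarTower F A A] [SMulCommClass F A A]
    (hF : (2 : F) ≠ 0) (h : IsNovikov A) (n : ℕ) :
    mulSpan^[2 * n] (lieSolvablePower F A 1) ≤ lieSolvablePower F A (n + 1) := by
  induction n with
  | zero => exact le_rfl
  | succ n ih =>
    rw [mul_add, add_comm, Function.iterate_add_apply]
    refine (mulSpan_mono.iterate 2 ih).trans ?_
    have hle : lieSolvablePower F A (n + 1) ≤ lieSolvablePower F A 1 := by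
      refine Submodule.span_mono ?_
      rintro _ ⟨x, -, y, -, rfl⟩
      exact ⟨x, trivial, y, trivial, rfl⟩
    have hI := isIdeal_lieSolvablePower hF h (F := F) (n + 1)
    have hI' := isIdeal_lieSolvablePower hF h (F := F) (n + 2)
    refine mulSpan_le.2 fun x hx y hy => ?_
    have hy' : y ∈ lieSolvablePower F A 1 :=
      hle (mulSpan_le.2 (fun a _ _ hb => hI.mul_left_mem a hb) hy)
    have hx' : x ∈ Submodule.span F {c : A | ∃ x ∈ lieSolvablePower F A (n + 1),
      ∃ y ∈ lieSolvablePower F A (n + 1), x * y = c} := hx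
    clear hx
    induction hx' using Submodule.span_induction with
    | mem x hx =>
      obtain ⟨f, hf, g, hg, rfl⟩ := hx
      exact mul_mul_mem_lieSolvablePower hF h hf hg hy'
    | zero => simp
    | add a b _ _ ha hb => rw [add_mul]; exact add_mem ha hb
    | smul r a _ ha => rw [smul_mul_assoc]; exact Submodule.smul_mem _ _ ha

/-! ### Nilpotent elements lie in solvable ideals. -/

/-- Modulo an ideal `J` over which `A` is commutative and associative, the ideal generated by `y`
consists of the elements `c • y + y * b`. -/
def adjoinElement [SMulCommClass F A A] (J : Submodule F A) (y : A) : Submodule F A :=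
  J ⊔ (F ∙ y) ⊔ LinearMap.range (LinearMap.mulLeft F y)

theorem mem_adjoinElement [SMulCommClass F A A] {J : Submodule F A} {y z : A} :
    z ∈ adjoinElement J y ↔ ∃ j ∈ J, ∃ c : F, ∃ b : A, z = j + (c • y + y * b) := by
  simp only [adjoinElement, Submodule.mem_sup, Submodule.mem_span_singleton, LinearMap.mem_range,
    LinearMap.mulLeft_apply]
  constructor
  · rintro ⟨_, ⟨j, hj, _, ⟨c, rfl⟩, rfl⟩, _, ⟨b, rfl⟩, rfl⟩
    exact ⟨j, hj, c, b, add_assoc _ _ _⟩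
  · rintro ⟨j, hj, c, b, rfl⟩
    exact ⟨_, ⟨j, hj, _, ⟨c, rfl⟩, rfl⟩, _, ⟨b, rfl⟩, add_assoc _ _ _⟩

theorem associator_mem_of_commutator_mem (h : IsNovikov A) {J : Submodule F A} (hJ : IsIdeal J)
    (hcomm : ∀ a b : A, a * b - b * a ∈ J) (a b c : A) : associator a b c ∈ J := by
  rw [h.associator_eq_commutators]
  exact add_mem (hJ.mul_right_mem _ (hcomm a b)) (hcomm _ _)

theorem isIdeal_adjoinElement [IsScalarTower F A A] [SMulCommClass F A A]
    (h : IsNovikov A) {J : Submodule F A} (hJ : IsIdeal J)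
    (hcomm : ∀ a b : A, a * b - b * a ∈ J) (y : A) : IsIdeal (adjoinElement J y) := by
  intro a z hz
  have hr : z * a ∈ adjoinElement J y := by
    obtain ⟨j, hj, c, b, rfl⟩ := mem_adjoinElement.1 hz
    refine mem_adjoinElement.2 ⟨j * a + associator y b a,
      add_mem (hJ.mul_right_mem _ hj) (associator_mem_of_commutator_mem h hJ hcomm _ _ _),
      0, c • a + b * a, ?_⟩
    simp only [associator, add_mul, mul_add, smul_mul_assoc, mul_smul_comm, zero_smul]
    abel
  refine ⟨?_, hr⟩
  rw [← sub_add_cancel (a * z) (z * a)]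
  exact add_mem (mem_adjoinElement.2 ⟨_, hcomm a z, 0, 0, by simp⟩) hr

theorem mul_mem_of_mem_adjoinElement [IsScalarTower F A A] [SMulCommClass F A A]
    (h : IsNovikov A) {J : Submodule F A} (hJ : IsIdeal J)
    (hcomm : ∀ a b : A, a * b - b * a ∈ J) {y : A} (hy : y * y ∈ J) {z w : A}
    (hz : z ∈ adjoinElement J y) (hw : w ∈ adjoinElement J y) : z * w ∈ J := by
  have h1 : ∀ b, y * (y * b) ∈ J := by
    intro b
    have e : y * (y * b) = y * y * b - associator y y b := by rw [associator]; abel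
    rw [e]
    exact sub_mem (hJ.mul_right_mem _ hy) (associator_mem_of_commutator_mem h hJ hcomm _ _ _)
  have h2 : ∀ w ∈ adjoinElement J y, y * w ∈ J := by
    intro w hw
    obtain ⟨j, hj, c, b, rfl⟩ := mem_adjoinElement.1 hw
    rw [mul_add, mul_add, mul_smul_comm]
    exact add_mem (hJ.mul_left_mem _ hj) (add_mem (Submodule.smul_mem _ _ hy) (h1 b))
  obtain ⟨j, hj, c, b, rfl⟩ := mem_adjoinElement.1 hz
  rw [add_mul, add_mul, smul_mul_assoc, h.right_comm]
  exact add_mem (hJ.mul_right_mem _ hj)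
    (add_mem (Submodule.smul_mem _ _ (h2 w hw)) (hJ.mul_right_mem _ (h2 w hw)))

/-- A nilpotent element lies in an ideal that is solvable modulo `C`, if the quotient by `C` is
commutative. -/
theorem exists_isSolvableOver_mem [IsScalarTower F A A] [SMulCommClass F A A]
    (h : IsNovikov A) {C : Submodule F A} (hC : IsIdeal C)
    (hcomm : ∀ a b : A, a * b - b * a ∈ C) {x : A} (hx : IsRNilpotent x) :
    ∃ J : Submodule F A, IsSolvableOver C J ∧ x ∈ J := by
  obtain ⟨n, hn⟩ := hx
  -- Descending induction on the exponent: J is enlarged to absorb ever lower powers, down to x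
  -- itself.
  have h0 : ∃ J : Submodule F A, IsSolvableOver C J ∧ leftPowSucc x n ∈ J :=
    ⟨C, .refl hC, hn ▸ C.zero_mem⟩
  clear hn
  induction n with
  | zero => exact h0
  | succ n ih =>
    obtain ⟨J, hJ, hxJ⟩ := h0
    have hc : ∀ a b : A, a * b - b * a ∈ J := fun a b => hJ.le (hcomm a b)
    -- For p = `leftPowSucc x n`, px lies in J, hence so does xp, and p² is xp multiplied n times by
    -- x on the right.
    have hy : leftPowSucc x n * leftPowSucc x n ∈ J := by
      have h1 : x * leftPowSucc x n ∈ J := by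
        rw [← sub_add_cancel (x * leftPowSucc x n) (leftPowSucc x n * x)]
        exact add_mem (hc _ _) hxJ
      rw [leftPowSucc_mul h]
      have hmaps : Set.MapsTo (fun a => a * x) (J : Set A) J :=
        fun _ ha => hJ.isIdeal.mul_right_mem x ha
      exact hmaps.iterate n h1
    obtain ⟨m, hm⟩ := hJ.solvable
    refine ih ⟨adjoinElement J (leftPowSucc x n),
      ⟨isIdeal_adjoinElement h hJ.isIdeal hc _, fun a ha =>
        mem_adjoinElement.2 ⟨a, hJ.le ha, 0, 0, by simp⟩, m + 1, ?_⟩,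
      mem_adjoinElement.2 ⟨0, J.zero_mem, 1, 0, by simp⟩⟩
    rw [Function.iterate_succ_apply]
    refine (mulSpan_mono.iterate m (mulSpan_le.2 fun a ha b hb => ?_)).trans hm
    exact mul_mem_of_mem_adjoinElement h hJ.isIdeal hc hy ha hb

/-! ### From r-nil to Baer-radical and to locally solvable. -/

theorem coe_mem_iterate_mulSpan_of_mem_derivedPower {S : NonUnitalSubalgebra F A}
    {J : Submodule F A} (hS : ∀ x ∈ S, x ∈ J) (m : ℕ) {x : S} (hx : x ∈ derivedPower F S m) :
    (x : A) ∈ mulSpan^[m] J := by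
  induction m generalizing x with
  | zero => exact hS x x.2
  | succ m ih =>
    rw [Function.iterate_succ_apply']
    have hle : derivedPower F S (m + 1) ≤
        (mulSpan (mulSpan^[m] J)).comap (NonUnitalSubalgebraClass.subtype S : S →ₗ[F] A) := by
      refine Submodule.span_le.2 ?_
      rintro _ ⟨a, ha, b, hb, rfl⟩
      exact mul_mem_mulSpan (ih ha) (ih hb)
    exact hle hx

theorem isSolvableOver_bot_lieSolvablePower_one [IsScalarTower F A A] [SMulCommClass F A A]
    (hF : (2 : F) ≠ 0) (h : IsNovikov A)
    (hL : IsLieSolvable F A) :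
    IsSolvableOver (⊥ : Submodule F A) (lieSolvablePower F A 1) := by
  obtain ⟨n, hn⟩ := hL
  refine ⟨isIdeal_lieSolvablePower hF h 1, bot_le, 2 * n,
    (iterate_mulSpan_lieSolvablePower_one_le hF h n).trans ?_⟩
  -- The bound ends at Lie power n + 1, which vanishes because the n-th does.
  refine Submodule.span_le.2 ?_
  rintro _ ⟨x, hx, y, hy, rfl⟩
  rw [hn, Submodule.mem_bot] at hx hy
  simp [hx, hy]

theorem exists_isSolvableOver_bot_mem [IsScalarTower F A A] [SMulCommClass F A A]
    (hF : (2 : F) ≠ 0) (h : IsNovikov A)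
    (hL : IsLieSolvable F A) {x : A} (hx : IsRNilpotent x) :
    ∃ J : Submodule F A, IsSolvableOver ⊥ J ∧ x ∈ J := by
  have hC := isSolvableOver_bot_lieSolvablePower_one hF h hL
  obtain ⟨J, hJ, hxJ⟩ := exists_isSolvableOver_mem h hC.isIdeal
    (fun a b => commutator_mem_lieSolvablePower (n := 0) trivial trivial) hx
  obtain ⟨m, hm⟩ := hJ.solvable
  obtain ⟨n, hn⟩ := hC.solvable
  refine ⟨J, ⟨hJ.isIdeal, bot_le, n + m, ?_⟩, hxJ⟩
  rw [Function.iterate_add_apply]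
  exact (mulSpan_mono.iterate n hm).trans hn

theorem IsBaerRadical.of_isRNil [IsScalarTower F A A] [SMulCommClass F A A]
    (hF : (2 : F) ≠ 0) (h : IsNovikov A)
    (hL : IsLieSolvable F A) (hA : IsRNil A) : IsBaerRadical F A := by
  refine eq_top_iff.2 fun x _ => ?_
  obtain ⟨J, hJ, hxJ⟩ := exists_isSolvableOver_bot_mem hF h hL (hA x)
  obtain ⟨m, hm⟩ := hJ.solvable
  exact le_baerRadical_of_iterate_mulSpan_le h hJ.isIdeal m (hm.trans bot_le) hxJ

theorem IsLocallySolvable.of_isRNil [IsScalarTower F A A] [SMulCommClass F A A]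
    (hF : (2 : F) ≠ 0) (h : IsNovikov A)
    (hL : IsLieSolvable F A) (hA : IsRNil A) : IsLocallySolvable F A := by
  classical
  intro s
  have key : ∃ J : Submodule F A, IsSolvableOver ⊥ J ∧ ∀ x ∈ s, x ∈ J := by
    induction s using Finset.induction_on with
    | empty => exact ⟨⊥, .refl isIdeal_bot, by simp⟩
    | insert a s _ ih =>
      obtain ⟨J, hJ, hs⟩ := ih
      obtain ⟨K, hK, ha⟩ := exists_isSolvableOver_bot_mem hF h hL (hA a)
      refine ⟨J ⊔ K, hJ.sup hK, fun x hx => ?_⟩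
      rcases Finset.mem_insert.1 hx with rfl | hx
      exacts [le_sup_right (a := J) ha, le_sup_left (b := K) (hs x hx)]
  obtain ⟨J, hJ, hs⟩ := key
  obtain ⟨m, hm⟩ := hJ.solvable
  have hS : ∀ x ∈ NonUnitalAlgebra.adjoin F (s : Set A), x ∈ J := by
    intro x hx
    induction hx using NonUnitalAlgebra.adjoin_induction with
    | mem x hx => exact hs x hx
    | add x y _ _ hx hy => exact add_mem hx hy
    | zero => exact J.zero_mem
    | mul x y _ _ _ hy => exact hJ.isIdeal.mul_left_mem x hy
    | smul r x _ hx => exact J.smul_mem r hx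
  refine ⟨m, (Submodule.eq_bot_iff _).2 fun x hx => Subtype.ext ?_⟩
  exact (Submodule.mem_bot F).1 (hm (coe_mem_iterate_mulSpan_of_mem_derivedPower hS m hx))

end Algebra

end NovikovAlgebra

theorem theorem2 {F : Type u} {A : Type v} [Field F] (hF : ringChar F ≠ 2)
    [NonUnitalNonAssocRing A] [Module F A] [IsScalarTower F A A] [SMulCommClass F A A]
    (hN : NovikovAlgebra.IsNovikov A) (hL : NovikovAlgebra.IsLieSolvable F A) :
    (NovikovAlgebra.IsBaerRadical F A ↔ NovikovAlgebra.IsRNil A) ∧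
    (NovikovAlgebra.IsRNil A ↔ NovikovAlgebra.IsLocallySolvable F A) :=
  have h2 : (2 : F) ≠ 0 := Ring.two_ne_zero hF
  ⟨⟨.of_isBaerRadical hN, .of_isRNil h2 hN hL⟩, ⟨.of_isRNil h2 hN hL, .of_isLocallySolvable hN⟩⟩
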